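/- \textbf{Setting.} Let $\mathcal U=[-1,1]^{\mathbb N}$ with the product topology and the uniform probability measure $\varrho$ (the infinite product of the normalized Lebesgue measure on $[-1,1]$). For $\rho\ge 1$ let $\mathcal E(\rho)=\{(z+z^{-1})/2: z\in\mathbb C,\ 1\le|z|\le\rho\}$, and for $\bm\rho=(\rho_j)_{j\in\mathbb N}\ge\bm 1$ let $\mathcal E(\bm\rho)=\mathcal E(\rho_1)\times\mathcal E(\rho_2)\times\cdots\subset\mathbb C^{\mathbb N}$. For $\bm b\in[0,\infty)^{\mathbb N}$ put $$\mathcal R(\bm b)=\bigcup\Big\{\mathcal E(\bm\rho):\bm\rho\ge\bm 1,\ \sum_{j=1}^\infty\Big(\tfrac{\rho_j+\rho_j^{-1}}2-1\Big)b_j\le 1\Big\}.$$ Let $\mathcal H(\bm b)$ be the set of continuous $f:\mathcal U\to\mathbb R$ that have an extension $\tilde f:\mathcal O\to\mathbb C$ to an open neighbourhood $\mathcal O\subseteq\mathbb C^{\mathbb N}$ (product topology) of $\mathcal R(\bm b)$ which is holomorphic, i.e. complex differentiable in each variable at each point of $\mathcal O$, and satisfies $\sup_{\bm z\in\mathcal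 R(\bm b)}|\tilde f(\bm z)|\le 1$. For $0<p<1$ let $\|\bm b\|_p=(\sum_j|b_j|^p)^{1/p}$ and $\|\bm b\|_{p,\mathsf M}=\|\tilde{\bm b}\|_p$, where $\tilde b_i=\sup_{j\ge i}|b_j|$, and let $$B_p=\{\bm b\in[0,\infty)^{\mathbb N}:\|\bm b\|_p\le1\},\qquad B_{p,\mathsf M}=\{\bm b\in[0,\infty)^{\mathbb N}:\|\bm b\|_{p,\mathsf M}\le 1\},$$ $$\mathcal H(p)=\bigcup_{\bm b\in B_p}\mathcal H(\bm b),\qquad \mathcal H(p,\mathsf M)=\bigcup_{\bm b\in B_{p,\mathsf M}}\mathcal H(\bm b).$$ An adaptive sampling operator is a map $\mathcal S:C(\mathcal U)\to\mathbb R^m$ of the form $\mathcal S(f)_i=S_i(f;\mathcal S(f)_1,\dots,\mathcal S(f)_{i-1})$, $i=1,\dots,m$, where $S_i:C(\mathcal U)\times\mathbb R^{i-1}\to\mathbb R$ is a bounded linear functional of its first argument for every value of the second. The adaptive $m$-width of $\mathcal K\subseteq C(\mathcal U)$ is $$\Theta_m(\mathcal K)=\inf_{\mathcal S,\mathcal R}\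 \sup_{f\in\mathcal K}\|f-\mathcal R(\mathcal S(f))\|_{L^2_\varrho(\mathcal U)},$$ with the infimum over all adaptive sampling operators $\mathcal S:C(\mathcal U)\to\mathbb R^m$ and all maps $\mathcal R:\mathbb R^m\to C(\mathcal U)$. Put $$\theta_m(p)=\Theta_m(\mathcal H(p)),\qquad \theta_m(p,\mathsf M)=\Theta_m(\mathcal H(p,\mathsf M)),$$ $$\overline{\theta_m}(p)=\sup_{\bm b\in B_p}\Theta_m(\mathcal H(\bm b)),\qquad \overline{\theta_m}(p,\mathsf M)=\sup_{\bm b\in B_{p,\mathsf M}}\Theta_m(\mathcal H(\bm b)).$$ \textbf{Theorem (Limits of learnability).} There is a universal constant $c>0$ such that, for all integers $m\ge1$ and all $0<p<1$: \begin{itemize} \item $\overline{\theta_m}(p)\ \ge\ \overline{\theta_m}(p,\mathsf M)\ \ge\ c\cdot 2^{-1/p}\, m^{1/2-1/p}$; \item $\theta_m(p)\ \ge\ c\cdot 2^{1/2-2/p}$; \item $\theta_m(p,\mathsf M)\ \ge\ \overline{\theta_m}(p,\mathsf M)\ \ge\ c\cdot 2^{-1/p}\, m^{1/2-1/p}$.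 \end{itemize} -/

import Mathlib

open MeasureTheory Filter Topology
open scoped ENNReal

noncomputable section

namespace HolWidth

/-! ### The domain and its uniform probability measure -/

/-- The parameter domain `[-1,1]^ℕ` with the product topology (a compact Hausdorff space). -/
abbrev U : Type := ℕ → Set.Icc (-1 : ℝ) 1

/-- The uniform probability measure on `[-1,1]`: half of the Lebesgue measure. -/
def unif : Measure (Set.Icc (-1 : ℝ) 1) :=
  (2 : ℝ≥0∞)⁻¹ • Measure.comap (Subtype.val : Set.Icc (-1 : ℝ) 1 → ℝ) volume

instance : IsProbabilityMeasure unif := ⟨by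
  have h : Measure.comap (Subtype.val : Set.Icc (-1 : ℝ) 1 → ℝ) volume Set.univ = 2 := by
    rw [comap_subtype_coe_apply measurableSet_Icc, Set.image_univ, Subtype.range_coe,
      Real.volume_Icc]
    norm_num
  rw [unif, Measure.smul_apply, h, smul_eq_mul]
  exact ENNReal.inv_mul_cancel (by norm_num) (by norm_num)⟩

/-- The uniform probability measure on `[-1,1]^ℕ`: the infinite product of `unif`. -/
def rho : Measure U := Measure.infinitePi (fun _ : ℕ => unif)

/-- The inclusion of `[-1,1]^ℕ` in `ℂ^ℕ`. -/
def toComplex (y : U) : ℕ → ℂ := fun j => ((y j : ℝ) : ℂ)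

/-! ### Holomorphic functions of infinitely many variables -/

/-- `F` is holomorphic in the open set `O ⊆ ℂ^ℕ`: it has a complex derivative with respect to
each variable at each point of `O`. Values of `F` outside `O` are irrelevant, since `O` is open. -/
def HolomorphicIn (F : (ℕ → ℂ) → ℂ) (O : Set (ℕ → ℂ)) : Prop :=
  IsOpen O ∧ ∀ z ∈ O, ∀ j : ℕ, DifferentiableAt ℂ (fun h : ℂ => F (z + Pi.single j h)) 0

/-- The (filled) Bernstein ellipse with parameter `ρ ≥ 1`; it is `[-1,1]` for `ρ = 1`. -/
def bernsteinEllipse (ρ : ℝ) : Set ℂ :=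
  {w | ∃ z : ℂ, 1 ≤ ‖z‖ ∧ ‖z‖ ≤ ρ ∧ w = (z + z⁻¹) / 2}

/-- The Bernstein polyellipse, a product of Bernstein ellipses. -/
def bernsteinPolyellipse (ρ : ℕ → ℝ) : Set (ℕ → ℂ) :=
  {w | ∀ j, w j ∈ bernsteinEllipse (ρ j)}

/-- The region `R(b,ε)`: the union of all Bernstein polyellipses with parameter `ρ ≥ 1` such that
`∑ j, ((ρ j + (ρ j)⁻¹) / 2 - 1) * b j` converges and is at most `ε`. -/
def region (b : ℕ → ℝ) (ε : ℝ) : Set (ℕ → ℂ) :=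
  {w | ∃ ρ : ℕ → ℝ, (∀ j, 1 ≤ ρ j) ∧
    Summable (fun j => ((ρ j + (ρ j)⁻¹) / 2 - 1) * b j) ∧
    ∑' j, ((ρ j + (ρ j)⁻¹) / 2 - 1) * b j ≤ ε ∧
    w ∈ bernsteinPolyellipse ρ}

/-- `F` is a holomorphic extension of the real function `f` on `[-1,1]^ℕ` to the (closed) set
`R`: it is holomorphic in some open neighbourhood of `R` and agrees with `f` on `[-1,1]^ℕ`. -/
def IsHolomorphicExtension (f : U → ℝ) (R : Set (ℕ → ℂ)) (F : (ℕ → ℂ) → ℂ) : Prop :=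
  (∃ O : Set (ℕ → ℂ), R ⊆ O ∧ HolomorphicIn F O) ∧ ∀ y : U, F (toComplex y) = (f y : ℂ)

/-- The class `H(b)` of (continuous, real-valued) `(b,1)`-holomorphic functions of norm at most
one on `R(b,1)`. -/
def H (b : ℕ → ℝ) : Set C(U, ℝ) :=
  {f | ∃ F : (ℕ → ℂ) → ℂ, IsHolomorphicExtension f (region b 1) F ∧
    ∀ z ∈ region b 1, ‖F z‖ ≤ 1}

/-! ### Sequence spaces and the classes `H(p)`, `H(p,M)` -/

/-- The `ℓ^p` (quasi-)norm of a real sequence, for `0 < p < ∞` and sequences in `ℓ^p`. -/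
def lpNorm (p : ℝ) (b : ℕ → ℝ) : ℝ := (∑' j, |b j| ^ p) ^ (1 / p)

/-- The minimal monotone majorant of a bounded sequence. -/
def majorant (b : ℕ → ℝ) : ℕ → ℝ := fun i => ⨆ j : {j : ℕ // i ≤ j}, |b j|

/-- The nonnegative sequences `b ∈ ℓ^p` with `‖b‖_p ≤ 1`. -/
def unitBall (p : ℝ) : Set (ℕ → ℝ) :=
  {b | (∀ j, 0 ≤ b j) ∧ Memℓp b (ENNReal.ofReal p) ∧ lpNorm p b ≤ 1}

/-- The nonnegative sequences `b` in the monotone `ℓ^p`-space with `‖b‖_{p,M} ≤ 1`. -/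
def unitBallM (p : ℝ) : Set (ℕ → ℝ) :=
  {b | (∀ j, 0 ≤ b j) ∧ Memℓp b ∞ ∧ Memℓp (majorant b) (ENNReal.ofReal p) ∧
    lpNorm p (majorant b) ≤ 1}

/-- The class `H(p)`. -/
def Hp (p : ℝ) : Set C(U, ℝ) := ⋃ b ∈ unitBall p, H b

/-- The class `H(p,M)`. -/
def HpM (p : ℝ) : Set C(U, ℝ) := ⋃ b ∈ unitBallM p, H b

/-! ### Adaptive widths -/

/-- `T : C(U) → ℝ^m` is an adaptive sampling operator: its `i`-th entry is `S i y f`, where `y` is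
the vector of the previous entries and `S i y` is, for every `y`, a bounded linear functional. -/
def IsAdaptiveSampling (m : ℕ) (T : C(U, ℝ) → (Fin m → ℝ)) : Prop :=
  ∃ S : (i : Fin m) → (Fin i.val → ℝ) → (C(U, ℝ) →L[ℝ] ℝ),
    ∀ (f : C(U, ℝ)) (i : Fin m),
      T f i = S i (fun j : Fin i.val => T f (Fin.castLE i.isLt.le j)) f

/-- The adaptive `m`-width of `K ⊆ C(U)`, with values in `[0,∞]`: the infimum over all adaptive
sampling operators `T` and all maps `R : ℝ^m → C(U)` of the worst-case `L²` error over `K`. -/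
def width (m : ℕ) (K : Set C(U, ℝ)) : ℝ≥0∞ :=
  ⨅ (T : C(U, ℝ) → (Fin m → ℝ)) (_ : IsAdaptiveSampling m T) (R : (Fin m → ℝ) → C(U, ℝ)),
    ⨆ f ∈ K, eLpNorm (fun y : U => f y - R (T f) y) 2 rho

/-- The width `θ_m(p)`, unknown anisotropy. -/
def theta (m : ℕ) (p : ℝ) : ℝ≥0∞ := width m (Hp p)

/-- The width `θ_m(p,M)`, unknown anisotropy. -/
def thetaM (m : ℕ) (p : ℝ) : ℝ≥0∞ := width m (HpM p)

/-- The width `\overline{θ_m}(p)`, known anisotropy. -/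
def thetaBar (m : ℕ) (p : ℝ) : ℝ≥0∞ := ⨆ b ∈ unitBall p, width m (H b)

/-- The width `\overline{θ_m}(p,M)`, known anisotropy. -/
def thetaBarM (m : ℕ) (p : ℝ) : ℝ≥0∞ := ⨆ b ∈ unitBallM p, width m (H b)

end HolWidth

end

/-! If `f` and `-f` both lie in the class and are annihilated by the `m` functionals used along the
all-zero sample history, both yield the samples `0` and get the same reconstruction, so the width is
at least the norm of `f` (`le_width`). Linear functions `∑ c k • coord k` suffice as `f`: their norm
is at least `√(∑ c k ^ 2 / 3)`, and they lie in `H b` when `|c k| ≤ b k / 2` and `b` has partial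
sums at most `1`. The functionals map the coordinates to vectors `a k` in `ℝ^m`, so the task is to
find large linear relations among these.

Known anisotropy: with `b` constant on `2 * m` coordinates, a kernel of codimension at most `m`
meets the unit cube in a point with at least `m` entries `±1` (`exists_mem_ker_mem_cube`).

Unknown anisotropy: `b` may depend on the relation. By compactness, two far terms of the bounded
sequence `a` differ by a combination of a finite spanning set with tiny coefficients
(`exists_sum_smul_eq_zero_of_bounded`), so the bound does not decay in `m`. -/

namespace HolWidth

open ProbabilityTheory

/-! ### Linear functions on `[-1,1]^ℕ` -/

/-- The `k`-th coordinate function on `[-1,1]^ℕ`. -/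
noncomputable def coord (k : ℕ) : C(U, ℝ) := ⟨fun y => (y k : ℝ), by fun_prop⟩

@[simp]
lemma coord_apply (k : ℕ) (y : U) : coord k y = (y k : ℝ) := rfl

lemma norm_coord_le (k : ℕ) : ‖coord k‖ ≤ 1 := by
  rw [ContinuousMap.norm_le _ zero_le_one]
  intro y
  exact abs_le.mpr ⟨(y k).2.1, (y k).2.2⟩

instance : IsProbabilityMeasure rho := by
  unfold rho
  infer_instance

lemma memLp_continuousMap (f : C(U, ℝ)) (q : ℝ≥0∞) : MemLp f q rho :=
  MemLp.of_bound f.continuous.measurable.aestronglyMeasurable ‖f‖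
    (Eventually.of_forall fun y => f.norm_coe_le_norm y)

lemma integral_unif (g : ℝ → ℝ) :
    ∫ x, g (x : ℝ) ∂unif = (1 / 2) * ∫ x in (-1 : ℝ)..1, g x := by
  rw [unif, integral_smul_measure, integral_subtype_comap measurableSet_Icc g,
    integral_Icc_eq_integral_Ioc, ← intervalIntegral.integral_of_le (by norm_num)]
  simp

lemma variance_unif : Var[fun x : Set.Icc (-1 : ℝ) 1 => (x : ℝ); unif] = 1 / 3 := by
  rw [variance_eq_integral (by fun_prop), integral_unif (fun x => x)]
  simp only [integral_id]
  rw [integral_unif (fun x => (x - 1 / 2 * ((1 ^ 2 - (-1) ^ 2) / 2)) ^ 2)]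
  norm_num

lemma variance_coord (k : ℕ) : Var[coord k; rho] = 1 / 3 := by
  rw [← variance_unif, ← (measurePreserving_eval_infinitePi (fun _ : ℕ => unif) k).map_eq,
    variance_map (by fun_prop) (by exact (measurable_pi_apply k).aemeasurable)]
  rfl

lemma variance_sum_coord (s : Finset ℕ) (c : ℕ → ℝ) :
    Var[(∑ k ∈ s, c k • coord k : C(U, ℝ)); rho] = (∑ k ∈ s, c k ^ 2) / 3 := by
  rw [ContinuousMap.coe_sum, IndepFun.variance_sum, Finset.sum_div]
  · refine Finset.sum_congr rfl fun k _ => ?_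
    rw [ContinuousMap.coe_smul, variance_smul, variance_coord]
    ring
  · exact fun k _ => memLp_continuousMap _ _
  · intro i _ j _ hij
    exact (iIndepFun_infinitePi (P := fun _ : ℕ => unif)
      (X := fun k (x : Set.Icc (-1 : ℝ) 1) => c k * (x : ℝ))
      (fun k => by fun_prop)).indepFun hij

/-- The second moment dominates the variance, which is additive over independent coordinates, so no
cross moments need computing. -/
lemma ofReal_sqrt_variance_le_eLpNorm (f : C(U, ℝ)) :
    ENNReal.ofReal (√(Var[f; rho])) ≤ eLpNorm f 2 rho := by
  rw [(memLp_continuousMap f 2).eLpNorm_eq_integral_rpow_norm two_ne_zero ENNReal.ofNat_ne_top]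
  refine ENNReal.ofReal_le_ofReal ?_
  rw [Real.sqrt_eq_rpow]
  simp only [ENNReal.toReal_ofNat, Real.rpow_ofNat, Real.norm_eq_abs, sq_abs, one_div]
  refine Real.rpow_le_rpow (variance_nonneg _ _) ?_ (by norm_num)
  exact variance_le_expectation_sq f.continuous.measurable.aestronglyMeasurable

lemma ofReal_sqrt_sum_sq_le_eLpNorm (s : Finset ℕ) (c : ℕ → ℝ) :
    ENNReal.ofReal (√((∑ k ∈ s, c k ^ 2) / 3)) ≤
      eLpNorm (∑ k ∈ s, c k • coord k : C(U, ℝ)) 2 rho := by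
  rw [← variance_sum_coord]
  exact ofReal_sqrt_variance_le_eLpNorm _

/-! ### Bernstein ellipses and linear functions in `H b` -/

lemma add_inv_le_add_inv {s t : ℝ} (hs : 1 ≤ s) (hst : s ≤ t) : s + s⁻¹ ≤ t + t⁻¹ := by
  have hs0 : 0 < s := by linarith
  have ht0 : 0 < t := by linarith
  have h : t + t⁻¹ - (s + s⁻¹) = (t - s) * (1 - s⁻¹ * t⁻¹) := by
    field_simp
    ring
  have h1 : s⁻¹ * t⁻¹ ≤ 1 :=
    mul_le_one₀ (inv_le_one_of_one_le₀ hs) (by positivity)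
      (inv_le_one_of_one_le₀ (hs.trans hst))
  nlinarith [mul_nonneg (sub_nonneg.mpr hst) (sub_nonneg.mpr h1)]

lemma norm_le_of_mem_bernsteinEllipse {ρ : ℝ} {w : ℂ} (hw : w ∈ bernsteinEllipse ρ) :
    ‖w‖ ≤ (ρ + ρ⁻¹) / 2 := by
  obtain ⟨z, h1, h2, rfl⟩ := hw
  calc ‖(z + z⁻¹) / 2‖ = ‖z + z⁻¹‖ / 2 := by simp
    _ ≤ (‖z‖ + ‖z‖⁻¹) / 2 := by
      gcongr
      exact (norm_add_le _ _).trans (by rw [norm_inv])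
    _ ≤ (ρ + ρ⁻¹) / 2 := by
      have := add_inv_le_add_inv h1 h2
      linarith

/-- Linear functions whose coefficients are dominated by `b / 2` belong to `H b`, if `b` has
partial sums at most `1`. -/
lemma sum_smul_coord_mem_H {b : ℕ → ℝ} (hb : ∀ j, 0 ≤ b j) {s : Finset ℕ}
    (hs : ∑ k ∈ s, b k ≤ 1) {c : ℕ → ℝ} (hc : ∀ k ∈ s, |c k| ≤ b k / 2) :
    ∑ k ∈ s, c k • coord k ∈ H b := by
  refine ⟨fun z => ∑ k ∈ s, (c k : ℂ) * z k, ⟨⟨Set.univ, Set.subset_univ _, isOpen_univ, ?_⟩, ?_⟩,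
    ?_⟩
  · intro z _ j
    refine DifferentiableAt.fun_sum fun k _ => ?_
    simp only [Pi.add_apply, Pi.single_apply]
    split_ifs <;> fun_prop
  · intro y
    simp [toComplex]
  · rintro z ⟨ρ, hρ, hsum, hle, hz⟩
    have hx : ∀ k, 0 ≤ (ρ k + (ρ k)⁻¹) / 2 - 1 := fun k => by
      have := add_inv_le_add_inv le_rfl (hρ k)
      norm_num at this
      linarith
    calc ‖∑ k ∈ s, (c k : ℂ) * z k‖ ≤ ∑ k ∈ s, ‖(c k : ℂ) * z k‖ := norm_sum_le _ _
      _ ≤ ∑ k ∈ s, b k / 2 * ((ρ k + (ρ k)⁻¹) / 2) := by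
        refine Finset.sum_le_sum fun k hk => ?_
        rw [norm_mul, Complex.norm_real, Real.norm_eq_abs]
        exact mul_le_mul (hc k hk) (norm_le_of_mem_bernsteinEllipse (hz k)) (norm_nonneg _)
          (by linarith [hb k])
      -- The first sum is at most `1` by definition of the region, the second by `hs`; the factor `1
      -- / 2` absorbs their total.
      _ = (∑ k ∈ s, ((ρ k + (ρ k)⁻¹) / 2 - 1) * b k + ∑ k ∈ s, b k) / 2 := by
        rw [← Finset.sum_add_distrib, Finset.sum_div]
        exact Finset.sum_congr rfl fun k _ => by ring
      _ ≤ 1 := by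
        have := hsum.sum_le_tsum s fun k _ => mul_nonneg (hx k) (hb k)
        linarith

/-! ### Adaptive widths -/

lemma width_mono (m : ℕ) {K K' : Set C(U, ℝ)} (h : K ⊆ K') : width m K ≤ width m K' :=
  iInf_mono fun _ => iInf_mono fun _ => iInf_mono fun _ => biSup_mono h

/-- Functions annihilated by the functionals that are used when all previous samples vanish have
vanishing samples. -/
lemma adaptiveSampling_eq_zero {m : ℕ} {T : C(U, ℝ) → (Fin m → ℝ)}
    {S : (i : Fin m) → (Fin i.val → ℝ) → (C(U, ℝ) →L[ℝ] ℝ)}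
    (hT : ∀ (f : C(U, ℝ)) (i : Fin m),
      T f i = S i (fun j : Fin i.val => T f (Fin.castLE i.isLt.le j)) f)
    {f : C(U, ℝ)} (hf : ∀ i, S i 0 f = 0) : T f = 0 := by
  have key : ∀ (n : ℕ) (hn : n < m), T f ⟨n, hn⟩ = 0 := by
    intro n
    induction n using Nat.strong_induction_on with
    | _ n ih =>
      intro hn
      have h0 : (fun j : Fin n => T f (Fin.castLE hn.le j)) = 0 :=
        funext fun j => ih j j.isLt _
      rw [hT]
      exact (congrArg (fun y => S ⟨n, hn⟩ y f) h0).trans (hf _)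
  exact funext fun i => key i i.isLt

/-- A lower bound for the adaptive width by the size of symmetric pairs in the kernel of `m`
functionals. -/
lemma le_width {m : ℕ} {K : Set C(U, ℝ)} {r : ℝ≥0∞}
    (h : ∀ Φ : Fin m → (C(U, ℝ) →L[ℝ] ℝ),
      ∃ f ∈ K, -f ∈ K ∧ (∀ i, Φ i f = 0) ∧ r ≤ eLpNorm f 2 rho) :
    r ≤ width m K := by
  refine le_iInf fun T => le_iInf fun ⟨S, hT⟩ => le_iInf fun R => ?_
  obtain ⟨f, hf, hf', hΦ, hr⟩ := h fun i => S i 0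
  have hT1 : T f = 0 := adaptiveSampling_eq_zero hT hΦ
  have hT2 : T (-f) = 0 := adaptiveSampling_eq_zero hT fun i => by simp [hΦ i]
  set E := ⨆ f ∈ K, eLpNorm (fun y : U => f y - R (T f) y) 2 rho
  have h1 : eLpNorm (⇑f - ⇑(R 0)) 2 rho ≤ E := by
    have := le_biSup (fun f : C(U, ℝ) => eLpNorm (fun y : U => f y - R (T f) y) 2 rho) hf
    rwa [hT1] at this
  have h2 : eLpNorm (-⇑f - ⇑(R 0)) 2 rho ≤ E := by
    have := le_biSup (fun f : C(U, ℝ) => eLpNorm (fun y : U => f y - R (T f) y) 2 rho) hf'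
    rwa [hT2] at this
  -- Both errors involve the same `R 0`, which cancels in the difference.
  have h3 : eLpNorm ((2 : ℝ) • ⇑f) 2 rho ≤ E + E := by
    have hsub : (2 : ℝ) • ⇑f = (⇑f - ⇑(R 0)) - (-⇑f - ⇑(R 0)) := by
      rw [two_smul]
      abel
    rw [hsub]
    refine (eLpNorm_sub_le ?_ ?_ (by norm_num)).trans (add_le_add h1 h2)
    · exact ((memLp_continuousMap f 2).sub (memLp_continuousMap (R 0) 2)).1
    · exact ((memLp_continuousMap f 2).neg.sub (memLp_continuousMap (R 0) 2)).1
  rw [eLpNorm_const_smul, ← two_mul] at h3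
  have h4 : ‖(2 : ℝ)‖ₑ = 2 := by simp [enorm_eq_nnnorm]
  rw [h4] at h3
  exact hr.trans ((ENNReal.mul_le_mul_iff_right (by norm_num) (by norm_num)).mp h3)

/-! ### Vectors in the kernel of a linear map -/

/-- A subspace of codimension at most `m` of `ℝⁿ` contains a vector of the unit cube with squared
Euclidean norm at least `n - m`. -/
lemma exists_mem_ker_mem_cube {ι E : Type*} [Fintype ι] [AddCommGroup E] [Module ℝ E]
    [FiniteDimensional ℝ E] (A : (ι → ℝ) →ₗ[ℝ] E) :
    ∃ x : ι → ℝ, A x = 0 ∧ (∀ i, |x i| ≤ 1) ∧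
      (Fintype.card ι : ℝ) - Module.finrank ℝ E ≤ ∑ i, x i ^ 2 := by
  classical
  set K : Set (ι → ℝ) := Metric.closedBall 0 1 ∩ (LinearMap.ker A : Set (ι → ℝ))
  have hK : IsCompact K := (isCompact_closedBall _ _).inter_right
    (LinearMap.ker A).closed_of_finiteDimensional
  have hmem : ∀ x, x ∈ K ↔ (∀ i, |x i| ≤ 1) ∧ A x = 0 := fun x => by
    simp [K, pi_norm_le_iff_of_nonneg]
  obtain ⟨x, hxK, hmax⟩ := hK.exists_isMaxOn ⟨0, by simp [hmem]⟩
    (f := fun x : ι → ℝ => ∑ i, x i ^ 2) (by fun_prop)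
  obtain ⟨hx1, hxA⟩ := (hmem x).mp hxK
  refine ⟨x, hxA, hx1, ?_⟩
  set s : Finset ι := {i | |x i| = 1}
  have hs : (s.card : ℝ) ≤ ∑ i, x i ^ 2 := by
    calc (s.card : ℝ) = ∑ i ∈ s, x i ^ 2 := by
          rw [Finset.card_eq_sum_ones, Nat.cast_sum]
          refine Finset.sum_congr rfl fun i hi => ?_
          rw [← sq_abs, (Finset.mem_filter.mp hi).2]
          simp
      _ ≤ ∑ i, x i ^ 2 :=
        Finset.sum_le_sum_of_subset_of_nonneg (Finset.subset_univ _) fun i _ _ => sq_nonneg _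
  -- With too few saturated entries, some nonzero kernel vector `v` vanishes on all of them. Then `x
  -- ± t v` stays in the cube for small `t`, and the parallelogram identity contradicts maximality.
  suffices h : Fintype.card ι ≤ Module.finrank ℝ E + s.card by
    have : (Fintype.card ι : ℝ) ≤ Module.finrank ℝ E + s.card := by exact_mod_cast h
    linarith
  by_contra! hlt
  have hker := LinearMap.ker_ne_bot_of_finrank_lt
    (f := A.prod (LinearMap.funLeft ℝ ℝ (Subtype.val : s → ι))) (by simpa using hlt)
  obtain ⟨v, hv, hv0⟩ := (Submodule.ne_bot_iff _).mp hker
  obtain ⟨hvA, hvs⟩ : A v = 0 ∧ ∀ i ∈ s, v i = 0 := by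
    rw [LinearMap.mem_ker] at hv
    exact ⟨congrArg Prod.fst hv, fun i hi => congrFun (congrArg Prod.snd hv) ⟨i, hi⟩⟩
  have hev : ∀ᶠ t : ℝ in 𝓝[>] 0, ∀ i, |x i| + t * |v i| ≤ 1 := by
    refine eventually_all.mpr fun i => ?_
    by_cases hi : i ∈ s
    · simp [hvs i hi, hx1 i]
    · have hlt : |x i| < 1 := lt_of_le_of_ne (hx1 i) fun h => hi (by simp [s, h])
      have hc : Tendsto (fun t : ℝ => |x i| + t * |v i|) (𝓝[>] 0) (𝓝 (|x i|)) := by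
        have : Continuous fun t : ℝ => |x i| + t * |v i| := by fun_prop
        simpa using (this.tendsto 0).mono_left nhdsWithin_le_nhds
      exact (hc.eventually_lt_const hlt).mono fun _ => le_of_lt
  obtain ⟨t, ht, ht0⟩ := (hev.and self_mem_nhdsWithin).exists
  have ht0 : 0 < t := ht0
  have hle : ∀ a : ℝ, |a| = t → ∑ i, (x i + a * v i) ^ 2 ≤ ∑ i, x i ^ 2 := fun a ha => by
    refine hmax (a := x + a • v) ((hmem _).mpr ⟨fun i => ?_, by simp [hxA, hvA]⟩)
    refine (abs_add_le _ _).trans ?_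
    simpa [abs_mul, ha] using ht i
  have h1 := hle t (abs_of_pos ht0)
  have h2 := hle (-t) (by rw [abs_neg, abs_of_pos ht0])
  have hpos : 0 < ∑ i, (t * v i) ^ 2 := by
    obtain ⟨i, hi⟩ := Function.ne_iff.mp hv0
    exact Finset.sum_pos' (fun i _ => sq_nonneg _)
      ⟨i, Finset.mem_univ _, by have : v i ≠ 0 := hi; positivity⟩
  have h3 : ∑ i, (x i + t * v i) ^ 2 + ∑ i, (x i + -t * v i) ^ 2
      = 2 * ∑ i, x i ^ 2 + 2 * ∑ i, (t * v i) ^ 2 := by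
    simp only [Finset.mul_sum, ← Finset.sum_add_distrib]
    exact Finset.sum_congr rfl fun i _ => by ring
  linarith

lemma exists_sum_range_smul_eq_zero {E : Type*} [AddCommGroup E] [Module ℝ E]
    [FiniteDimensional ℝ E] (a : ℕ → E) (n : ℕ) :
    ∃ x : ℕ → ℝ, ∑ k ∈ Finset.range n, x k • a k = 0 ∧ (∀ k, |x k| ≤ 1) ∧
      (n : ℝ) - Module.finrank ℝ E ≤ ∑ k ∈ Finset.range n, x k ^ 2 := by
  obtain ⟨x, hx0, hx1, hx2⟩ :=
    exists_mem_ker_mem_cube (Fintype.linearCombination ℝ fun k : Fin n => a k)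
  refine ⟨fun k => if h : k < n then x ⟨k, h⟩ else 0, ?_, fun k => ?_, ?_⟩
  · simpa [Finset.sum_range, Fintype.linearCombination_apply] using hx0
  · dsimp only
    split_ifs with h
    · exact hx1 _
    · simp
  · simpa [Finset.sum_range] using hx2

/-- A bounded sequence in a finite-dimensional space satisfies a finite linear relation whose
coefficients are `1`, `-1` and otherwise arbitrarily small. -/
lemma exists_sum_smul_eq_zero_of_bounded {E : Type*} [NormedAddCommGroup E] [NormedSpace ℝ E]
    [FiniteDimensional ℝ E] {a : ℕ → E} {C : ℝ} (ha : ∀ k, ‖a k‖ ≤ C) {p : ℝ} (hp : 0 < p) :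
    ∃ (s : Finset ℕ) (x : ℕ → ℝ), ∑ k ∈ s, x k • a k = 0 ∧ ∑ k ∈ s, |x k| ^ p ≤ 4 ∧
      2 ≤ ∑ k ∈ s, x k ^ 2 := by
  classical
  obtain ⟨J', hJ', hspan⟩ := (Submodule.fg_span_iff_fg_span_finset_subset (R := ℝ)
    (Set.range a)).mp (IsNoetherian.noetherian _)
  obtain ⟨J, rfl⟩ : ∃ J : Finset ℕ, J.image a = J' := by
    obtain ⟨J, -, hJ⟩ := Finset.subset_set_image_iff.mp
      (show (J' : Set E) ⊆ a '' Set.univ by rwa [Set.image_univ])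
    exact ⟨J, hJ⟩
  set G : (J → ℝ) →ₗ[ℝ] E := Fintype.linearCombination ℝ fun k : J => a k
  have hG : ∀ k, a k ∈ LinearMap.range G := fun k => by
    rw [Fintype.range_linearCombination]
    have hr : Set.range (fun k : J => a k) = (J.image a : Set E) := by
      ext
      simp
    rw [hr, ← hspan]
    exact Submodule.subset_span ⟨k, rfl⟩
  -- A linear choice of coefficients is automatically bounded here, so `u` inherits boundedness from
  -- `a`.
  obtain ⟨g, hg⟩ := G.rangeRestrict.exists_rightInverse_of_surjective G.range_rangeRestrict
  set u : ℕ → J → ℝ := fun k => g ⟨a k, hG k⟩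
  have hGu : ∀ k, G (u k) = a k := fun k =>
    congrArg Subtype.val (LinearMap.congr_fun hg ⟨a k, hG k⟩)
  have hu : ∀ k, u k ∈ Metric.closedBall (0 : J → ℝ) (‖g.toContinuousLinearMap‖ * C) := fun k => by
    rw [mem_closedBall_zero_iff]
    exact (g.toContinuousLinearMap.le_opNorm _).trans
      (mul_le_mul_of_nonneg_left (ha k) (norm_nonneg _))
  obtain ⟨l, -, φ, hφ, hlim⟩ := tendsto_subseq_of_bounded Metric.isBounded_closedBall hu
  -- Chosen so that `J.card * δ ^ p ≤ 2`; the entries `±1` contribute the other `2`.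
  set δ : ℝ := (2 / (J.card + 1 : ℝ)) ^ (1 / p)
  have hδ : 0 < δ := by positivity
  have hδp : δ ^ p = 2 / (J.card + 1 : ℝ) := by
    rw [← Real.rpow_mul (by positivity), one_div_mul_cancel hp.ne', Real.rpow_one]
  obtain ⟨N, hN⟩ := Metric.cauchySeq_iff.mp hlim.cauchySeq δ hδ
  -- Since `φ M ≥ M`, this also pushes `i` and `j` beyond every index in `J`.
  set M := max N (J.sup id + 1)
  set i := φ M
  set j := φ (M + 1)
  have hij : i < j := hφ (Nat.lt_succ_self M)
  have hJlt : ∀ k ∈ J, k < i := fun k hk =>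
    calc k ≤ J.sup id := Finset.le_sup (f := id) hk
      _ < M := lt_of_lt_of_le (Nat.lt_succ_self _) (le_max_right _ _)
      _ ≤ i := hφ.id_le M
  have hd : ‖u j - u i‖ < δ := by
    rw [← dist_eq_norm]
    exact hN _ ((le_max_left _ _).trans (Nat.le_succ M)) _ (le_max_left _ _)
  set t : J → ℝ := u j - u i
  have htk : ∀ k, |t k| ≤ δ := fun k => (norm_le_pi_norm t k).trans hd.le
  -- The relation is `G (u j - u i) + a i - a j = 0`.
  set x : ℕ → ℝ := fun k => if h : k ∈ J then t ⟨k, h⟩ else if k = i then 1 else -1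
  have hiJ : i ∉ J := fun h => lt_irrefl _ (hJlt i h)
  have hjJ : j ∉ J := fun h => lt_asymm hij (hJlt j h)
  have hjs : j ∉ insert i J := fun h =>
    (Finset.mem_insert.mp h).elim hij.ne' hjJ
  have hxi : x i = 1 := (dif_neg hiJ).trans (if_pos rfl)
  have hxj : x j = -1 := (dif_neg hjJ).trans (if_neg hij.ne')
  have hxJ : ∀ k : J, x k = t k := fun k => dif_pos k.2
  refine ⟨insert j (insert i J), x, ?_, ?_, ?_⟩
  · have hsum : ∑ k ∈ J, x k • a k = G t := by
      rw [← Finset.sum_coe_sort]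
      simp only [hxJ, G, Fintype.linearCombination_apply]
    rw [Finset.sum_insert hjs, Finset.sum_insert hiJ, hxi, hxj, hsum, map_sub, hGu, hGu]
    module
  · have hsum : ∑ k ∈ J, |x k| ^ p ≤ 2 := by
      rw [← Finset.sum_coe_sort]
      calc ∑ k : J, |x k| ^ p ≤ ∑ _k : J, δ ^ p := by
            refine Finset.sum_le_sum fun k _ => ?_
            rw [hxJ]
            exact Real.rpow_le_rpow (abs_nonneg _) (htk k) hp.le
        _ = J.card * (2 / (J.card + 1 : ℝ)) := by
          rw [hδp, Finset.sum_const, Finset.card_univ, Fintype.card_coe, nsmul_eq_mul]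
        _ ≤ 2 := by
          rw [mul_div_assoc', div_le_iff₀ (Nat.cast_add_one_pos _)]
          linarith
    rw [Finset.sum_insert hjs, Finset.sum_insert hiJ, hxi, hxj]
    simp only [abs_neg, abs_one, Real.one_rpow]
    linarith
  · have hsum : 0 ≤ ∑ k ∈ J, x k ^ 2 := Finset.sum_nonneg fun k _ => sq_nonneg _
    rw [Finset.sum_insert hjs, Finset.sum_insert hiJ, hxi, hxj]
    linarith

/-! ### Lower bounds -/

/-- A lower bound for the adaptive width of a class that contains all linear functions with
coefficients dominated by those of some linear relation between the samples of the coordinates. -/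
lemma le_width_of_linear_relation {m : ℕ} {K : Set C(U, ℝ)} {β r : ℝ} (hβ : 0 ≤ β)
    (h : ∀ (a : ℕ → Fin m → ℝ) (C : ℝ), (∀ k, ‖a k‖ ≤ C) →
      ∃ (s : Finset ℕ) (x : ℕ → ℝ), ∑ k ∈ s, x k • a k = 0 ∧ r ≤ ∑ k ∈ s, x k ^ 2 ∧
        ∀ c : ℕ → ℝ, (∀ k ∈ s, |c k| ≤ β * |x k|) → ∑ k ∈ s, c k • coord k ∈ K) :
    ENNReal.ofReal (β * √(r / 3)) ≤ width m K := by
  refine le_width fun Φ => ?_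
  obtain ⟨s, x, hx0, hr, hK⟩ := h (fun k i => Φ i (coord k)) ‖Φ‖ fun k => by
    refine (pi_norm_le_iff_of_nonneg (norm_nonneg _)).mpr fun i => ?_
    exact ((Φ i).le_opNorm _).trans
      ((mul_le_of_le_one_right (norm_nonneg _) (norm_coord_le k)).trans (norm_le_pi_norm Φ i))
  refine ⟨∑ k ∈ s, (β * x k) • coord k, hK _ fun k _ => ?_, ?_, fun i => ?_, ?_⟩
  · rw [abs_mul, abs_of_nonneg hβ]
  · rw [← Finset.sum_neg_distrib]
    simp only [← neg_smul]
    refine hK _ fun k _ => ?_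
    rw [abs_neg, abs_mul, abs_of_nonneg hβ]
  · have := congrFun hx0 i
    simp only [Finset.sum_apply, Pi.smul_apply, smul_eq_mul, Pi.zero_apply] at this
    simp only [map_sum, map_smul, smul_eq_mul, mul_assoc, ← Finset.mul_sum, this, mul_zero]
  · refine le_trans (ENNReal.ofReal_le_ofReal ?_) (ofReal_sqrt_sum_sq_le_eLpNorm _ _)
    simp only [mul_pow, ← Finset.mul_sum]
    rw [mul_div_assoc, Real.sqrt_mul (sq_nonneg β), Real.sqrt_sq hβ]
    gcongr

/-! ### Unit balls of the sequence spaces -/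

lemma memℓp_ofReal_iff {p : ℝ} (hp : 0 < p) {b : ℕ → ℝ} :
    Memℓp b (ENNReal.ofReal p) ↔ Summable fun j => |b j| ^ p := by
  have h := ENNReal.toReal_ofReal hp.le
  rw [memℓp_gen_iff (by rwa [h]), h]
  rfl

lemma lpNorm_le_one_iff {p : ℝ} (hp : 0 < p) {b : ℕ → ℝ} :
    lpNorm p b ≤ 1 ↔ ∑' j, |b j| ^ p ≤ 1 := by
  have h0 : 0 ≤ ∑' j, |b j| ^ p := tsum_nonneg fun j => by positivity
  rw [lpNorm]
  constructor
  · intro h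
    by_contra! h1
    exact absurd h (not_le.mpr (Real.one_lt_rpow h1 (by positivity)))
  · intro h
    exact Real.rpow_le_one h0 h (by positivity)

lemma unitBallM_subset_unitBall {p : ℝ} (hp : 0 < p) : unitBallM p ⊆ unitBall p := by
  rintro b ⟨hb, hbdd, hmem, hle⟩
  rw [memℓp_infty_iff] at hbdd
  rw [memℓp_ofReal_iff hp] at hmem
  rw [lpNorm_le_one_iff hp] at hle
  -- Boundedness is essential: a real supremum of an unbounded set defaults to `0`.
  have hmaj : ∀ j, |b j| ≤ |majorant b j| := fun j =>
    (le_ciSup (f := fun k : {k : ℕ // j ≤ k} => |b k|)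
      (hbdd.mono (by rintro _ ⟨k, rfl⟩; exact ⟨k, rfl⟩)) ⟨j, le_rfl⟩).trans (le_abs_self _)
  have hpow : ∀ j, |b j| ^ p ≤ |majorant b j| ^ p := fun j =>
    Real.rpow_le_rpow (abs_nonneg _) (hmaj j) hp.le
  have hsum : Summable fun j => |b j| ^ p :=
    Summable.of_nonneg_of_le (fun j => by positivity) hpow hmem
  exact ⟨hb, (memℓp_ofReal_iff hp).mpr hsum,
    (lpNorm_le_one_iff hp).mpr ((hsum.tsum_le_tsum hpow hmem).trans hle)⟩

/-- Each entry is at most `1`, hence `b k ≤ |b k| ^ p` for `p < 1`. -/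
lemma sum_le_one_of_mem_unitBall {p : ℝ} (hp : 0 < p) (hp1 : p < 1) {b : ℕ → ℝ}
    (hb : b ∈ unitBall p) (s : Finset ℕ) : ∑ k ∈ s, b k ≤ 1 := by
  obtain ⟨hb0, hmem, hle⟩ := hb
  rw [memℓp_ofReal_iff hp] at hmem
  rw [lpNorm_le_one_iff hp] at hle
  have hs : ∀ s : Finset ℕ, ∑ k ∈ s, |b k| ^ p ≤ 1 := fun s =>
    (hmem.sum_le_tsum s fun k _ => by positivity).trans hle
  refine le_trans (Finset.sum_le_sum fun k _ => ?_) (hs s)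
  have h1 : |b k| ^ p ≤ 1 := by simpa using hs {k}
  have h2 : |b k| ≤ 1 := by
    by_contra! h
    exact absurd h1 (not_le.mpr (Real.one_lt_rpow h hp))
  calc b k ≤ |b k| ^ (1 : ℝ) := by rw [Real.rpow_one]; exact le_abs_self _
    _ ≤ |b k| ^ p := Real.rpow_le_rpow_of_exponent_ge_of_imp (abs_nonneg _) h2 hp1.le
      (fun _ h => absurd h one_ne_zero)

lemma majorant_eq_self {b : ℕ → ℝ} (hb0 : ∀ j, 0 ≤ b j) (hb : Antitone b) : majorant b = b := by
  funext i
  have hle : ∀ k : {k : ℕ // i ≤ k}, |b k| ≤ b i := fun k => by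
    rw [abs_of_nonneg (hb0 k)]
    exact hb k.2
  have : Nonempty {k : ℕ // i ≤ k} := ⟨⟨i, le_rfl⟩⟩
  refine le_antisymm (ciSup_le hle) ((le_abs_self _).trans ?_)
  exact le_ciSup (f := fun k : {k : ℕ // i ≤ k} => |b k|)
    ⟨b i, by rintro _ ⟨k, rfl⟩; exact hle k⟩ ⟨i, le_rfl⟩

/-- The sequence with `n` leading entries `n ^ (-1 / p)`, followed by zeros. -/
noncomputable def blockSeq (p : ℝ) (n : ℕ) : ℕ → ℝ :=
  fun j => if j < n then (n : ℝ) ^ (-(1 / p)) else 0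

lemma blockSeq_nonneg (p : ℝ) (n j : ℕ) : 0 ≤ blockSeq p n j := by
  rw [blockSeq]
  split_ifs <;> positivity

lemma blockSeq_antitone (p : ℝ) (n : ℕ) : Antitone (blockSeq p n) := by
  intro i j hij
  by_cases hj : j < n
  · simp [blockSeq, hj, hij.trans_lt hj]
  · have : blockSeq p n j = 0 := if_neg hj
    rw [this]
    exact blockSeq_nonneg p n i

lemma blockSeq_mem_unitBallM {p : ℝ} (hp : 0 < p) {n : ℕ} (hn : 0 < n) :
    blockSeq p n ∈ unitBallM p := by
  have hs : HasSum (fun j => |blockSeq p n j| ^ p) 1 := by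
    have h0 : ∀ j ∉ Finset.range n, |blockSeq p n j| ^ p = 0 := fun j hj => by
      rw [blockSeq, if_neg (by simpa using hj), abs_zero, Real.zero_rpow hp.ne']
    suffices h : ∑ j ∈ Finset.range n, |blockSeq p n j| ^ p = 1 by
      simpa only [h] using hasSum_sum_of_ne_finset_zero h0
    have h1 : ∀ j ∈ Finset.range n, |blockSeq p n j| ^ p = (n : ℝ)⁻¹ := fun j hj => by
      rw [abs_of_nonneg (blockSeq_nonneg p n j), blockSeq, if_pos (Finset.mem_range.mp hj),
        ← Real.rpow_mul (Nat.cast_nonneg n), neg_mul, one_div_mul_cancel hp.ne', Real.rpow_neg_one]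
    rw [Finset.sum_congr rfl h1, Finset.sum_const, Finset.card_range, nsmul_eq_mul,
      mul_inv_cancel₀ (by positivity)]
  have hmaj := majorant_eq_self (blockSeq_nonneg p n) (blockSeq_antitone p n)
  refine ⟨blockSeq_nonneg p n, ?_, ?_, ?_⟩
  · refine memℓp_infty_iff.mpr ⟨blockSeq p n 0, ?_⟩
    rintro _ ⟨j, rfl⟩
    dsimp only
    rw [Real.norm_eq_abs, abs_of_nonneg (blockSeq_nonneg p n j)]
    exact blockSeq_antitone p n (Nat.zero_le j)
  · rw [hmaj, memℓp_ofReal_iff hp]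
    exact hs.summable
  · rw [hmaj, lpNorm_le_one_iff hp, hs.tsum_eq]

lemma le_width_H_blockSeq {m : ℕ} (hm : 1 ≤ m) {p : ℝ} (hp : 0 < p) (hp1 : p < 1) :
    ENNReal.ofReal (√(1 / 3) / 2 * (2 : ℝ) ^ (-(1 / p)) * (m : ℝ) ^ (1 / 2 - 1 / p))
      ≤ width m (H (blockSeq p (2 * m))) := by
  have hm0 : (0 : ℝ) < m := by exact_mod_cast hm
  have key := le_width_of_linear_relation (m := m) (K := H (blockSeq p (2 * m)))
    -- `β` is half the block height, and `r = 2 * m - m`.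
    (β := ((2 * m : ℕ) : ℝ) ^ (-(1 / p)) / 2) (r := m) (by positivity) fun a C _ => by
      obtain ⟨x, hx0, hx1, hx2⟩ := exists_sum_range_smul_eq_zero a (2 * m)
      refine ⟨_, x, hx0, ?_, fun c hc => sum_smul_coord_mem_H (blockSeq_nonneg _ _)
        (sum_le_one_of_mem_unitBall hp hp1
          (unitBallM_subset_unitBall hp (blockSeq_mem_unitBallM hp (by omega))) _) fun k hk => ?_⟩
      · rw [Module.finrank_fin_fun] at hx2
        push_cast at hx2
        linarith
      · rw [blockSeq, if_pos (Finset.mem_range.mp hk)]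
        exact (hc k hk).trans (mul_le_of_le_one_right (by positivity) (hx1 k))
  refine le_trans (ENNReal.ofReal_le_ofReal (le_of_eq ?_)) key
  rw [Nat.cast_mul, Real.mul_rpow (by positivity) (by positivity), div_eq_mul_one_div (m : ℝ),
    Real.sqrt_mul hm0.le, sub_eq_add_neg, Real.rpow_add hm0, ← Real.sqrt_eq_rpow]
  push_cast
  ring

lemma le_theta (m : ℕ) {p : ℝ} (hp : 0 < p) (hp1 : p < 1) :
    ENNReal.ofReal (√(1 / 3) / 2 * (2 : ℝ) ^ (1 / 2 - 2 / p)) ≤ theta m p := by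
  have key := le_width_of_linear_relation (m := m) (K := Hp p)
    (β := (4 : ℝ) ^ (-(1 / p)) / 2) (r := 2) (by positivity) fun a C ha => by
      obtain ⟨s, x, hx0, hx1, hx2⟩ := exists_sum_smul_eq_zero_of_bounded ha hp
      refine ⟨s, x, hx0, hx2, fun c hc => ?_⟩
      -- The anisotropy is fitted to the relation; `4 ^ (-(1 / p))` normalises `∑ |x k| ^ p ≤ 4`.
      set b : ℕ → ℝ := fun k => if k ∈ s then (4 : ℝ) ^ (-(1 / p)) * |x k| else 0
      have hb0 : ∀ k, 0 ≤ b k := fun k => by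
        dsimp only [b]
        split_ifs <;> positivity
      have hout : ∀ k ∉ s, |b k| ^ p = 0 := fun k hk => by
        simp only [b, if_neg hk, abs_zero, Real.zero_rpow hp.ne']
      have hin : ∀ k ∈ s, |b k| ^ p = 4⁻¹ * |x k| ^ p := fun k hk => by
        rw [abs_of_nonneg (hb0 k)]
        simp only [b, if_pos hk]
        rw [Real.mul_rpow (by positivity) (by positivity), ← Real.rpow_mul (by norm_num), neg_mul,
          one_div_mul_cancel hp.ne', Real.rpow_neg_one]
      have hb : b ∈ unitBall p := by
        refine ⟨hb0, (memℓp_ofReal_iff hp).mpr (summable_of_ne_finset_zero hout),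
          (lpNorm_le_one_iff hp).mpr ?_⟩
        rw [tsum_eq_sum hout, Finset.sum_congr rfl hin, ← Finset.mul_sum]
        linarith
      refine Set.mem_biUnion hb (sum_smul_coord_mem_H hb0
        (sum_le_one_of_mem_unitBall hp hp1 hb s) fun k hk => (hc k hk).trans (le_of_eq ?_))
      simp only [b, if_pos hk]
      ring
  refine le_trans (ENNReal.ofReal_le_ofReal (le_of_eq ?_)) key
  have h4 : (4 : ℝ) ^ (-(1 / p)) = 2 ^ (-(2 / p)) := by
    rw [show (4 : ℝ) = 2 ^ (2 : ℝ) by norm_num, ← Real.rpow_mul (by norm_num)]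
    congr 1
    ring
  rw [h4, div_eq_mul_one_div (2 : ℝ) 3, Real.sqrt_mul (by norm_num), sub_eq_add_neg,
    Real.rpow_add (by norm_num), ← Real.sqrt_eq_rpow]
  ring

lemma thetaBarM_le_thetaBar (m : ℕ) {p : ℝ} (hp : 0 < p) : thetaBarM m p ≤ thetaBar m p :=
  biSup_mono (unitBallM_subset_unitBall hp)

lemma thetaBarM_le_thetaM (m : ℕ) (p : ℝ) : thetaBarM m p ≤ thetaM m p :=
  iSup₂_le fun _ hb => width_mono m (Set.subset_biUnion_of_mem hb)

lemma le_thetaBarM {m : ℕ} (hm : 1 ≤ m) {p : ℝ} (hp : 0 < p) (hp1 : p < 1) :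
    ENNReal.ofReal (√(1 / 3) / 2 * (2 : ℝ) ^ (-(1 / p)) * (m : ℝ) ^ (1 / 2 - 1 / p))
      ≤ thetaBarM m p :=
  (le_width_H_blockSeq hm hp hp1).trans
    (le_biSup (fun b => width m (H b)) (blockSeq_mem_unitBallM hp (by omega)))

end HolWidth

theorem theoremt :
    ∃ c : ℝ, 0 < c ∧ ∀ (m : ℕ) (p : ℝ), 1 ≤ m → 0 < p → p < 1 →
      (HolWidth.thetaBarM m p ≤ HolWidth.thetaBar m p ∧
        ENNReal.ofReal (c * (2 : ℝ) ^ (-(1 / p)) * (m : ℝ) ^ (1 / 2 - 1 / p))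
          ≤ HolWidth.thetaBarM m p) ∧
      ENNReal.ofReal (c * (2 : ℝ) ^ (1 / 2 - 2 / p)) ≤ HolWidth.theta m p ∧
      (HolWidth.thetaBarM m p ≤ HolWidth.thetaM m p ∧
        ENNReal.ofReal (c * (2 : ℝ) ^ (-(1 / p)) * (m : ℝ) ^ (1 / 2 - 1 / p))
          ≤ HolWidth.thetaBarM m p) := by
  -- `√(1 / 3)` is the standard deviation of a coordinate; the half comes from `|c k| ≤ b k / 2`.
  refine ⟨√(1 / 3) / 2, by positivity, fun m p hm hp hp1 => ?_⟩
  have h := HolWidth.le_thetaBarM hm hp hp1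
  exact ⟨⟨HolWidth.thetaBarM_le_thetaBar m hp, h⟩, HolWidth.le_theta m hp hp1,
    HolWidth.thetaBarM_le_thetaM m p, h⟩
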